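/- **Model.** A network has nodes $V=\{1,\dots,n\}$ and $r$ epochs. In epoch $m$ the topology is a directed graph without loops, given by neighbour sets $N_m(i)\subseteq V\setminus\{i\}$, where $N_m(i)$ is the set of nodes whose states node $i$ uses; the weights are $W^{(m)}_{ij}$ and the epoch has length $\delta_m$. For a leader set $S$, let $L_m(S)$ be the $n\times n$ matrix whose rows in $S$ vanish and which for $i\notin S$ has entries $L_{ij}=-W^{(m)}_{ij}$ if $j\in N_m(i)$, $L_{ii}=\sum_{j\in N_m(i)}W^{(m)}_{ij}$, and $0$ otherwise. With $P=e^{-L_m(S)\delta_m}$ and a fixed $p\in[1,\infty)$, the convergence error of $S$ in epoch $m$ is $$\hat f_m(S)=\sum_{i\in V\setminus S}\Big[\sum_{j\in V\setminus S}P_{ij}^{\,p}+\Big(1-\sum_{j\in S}P_{ij}\Big)^p\Big].$$ The regret of leader sets $S_1,\dots,S_r$ with $|S_m|\le k$ is $$R=\frac1r\sum_{m=1}^r\hat f_m(S_m)-\min_{|S|\le k}\frac1r\sum_{m=1}^r\hat f_m(S).$$ A leader selection algorithm without topology knowledge chooses $S_m$ as a function of the topologies of epochs $1,\dots,m-1$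 and of its own internal randomness, which is independent of the topologies. **Theorem.** Let $k=1$, $p\ge1$, $w>0$, $\gamma>0$. There are $n_0,r_0$ depending only on $p,w,\gamma$ such that for all $n\ge n_0$, $r\ge r_0$ and all epoch lengths $\delta_m\ge\gamma$ the following hold. 1. For all weights with $W^{(m)}_{ij}\ge w$ for $i\neq j$, and for every (possibly randomized) leader selection algorithm without topology knowledge, there is a sequence of topologies on which the regret, in expectation over the algorithm's randomness, satisfies $$\mathbf E[R]\ \ge\ \frac1r\sqrt{\frac r2\ln n}.$$ 2. If in each epoch all weights are equal, $W^{(m)}_{ij}=c_m\ge w$, consider the random topology sequence in which, independently over all nodes and all epochs, each node $i$ is with probability $1/2$ connected to all other nodes ($i\in N_m(j)$ for all $j\ne i$) and with probability $1/2$ to none ($i\notin N_m(j)$ for all $j$). For every such algorithm, the regret on this random sequence, in expectation over the topologies and the algorithm's randomness, is at least $\frac1r\sqrt{\frac r2\ln n}$. -/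

import Mathlib

open scoped BigOperators

noncomputable section

/-- A directed communication topology on the nodes `0, …, n-1`, given by the neighbour sets: `G.1 i`
is the set `N(i)` of nodes whose states node `i` uses in its update. There are no self-loops. -/
abbrev NetTopology (n : ℕ) : Type :=
  {N : Fin n → Finset (Fin n) // ∀ i, i ∉ N i}

/-- Sets of at most `k` leaders. -/
abbrev LeaderSet (n k : ℕ) : Type :=
  {S : Finset (Fin n) // S.card ≤ k}

/-- The Laplacian of the leader-follower dynamics
`x_i' = ∑_{j ∈ N(i)} W_ij (x_j - x_i)` for `i ∉ S`, and `x_i' = 0` for `i ∈ S`;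
that is, `x' = - L x`. -/
def leaderLaplacian {n : ℕ} (W : Matrix (Fin n) (Fin n) ℝ) (G : NetTopology n)
    (S : Finset (Fin n)) : Matrix (Fin n) (Fin n) ℝ :=
  Matrix.of fun i j =>
    if i ∈ S then 0
    else if i = j then ∑ l ∈ G.1 i, W i l
    else if j ∈ G.1 i then -W i j
    else 0

/-- The (stochastic) transition matrix `exp (-L d)` over a time interval of length `d`. -/
def transitionMatrix {n : ℕ} (W : Matrix (Fin n) (Fin n) ℝ) (G : NetTopology n) (d : ℝ)
    (S : Finset (Fin n)) : Matrix (Fin n) (Fin n) ℝ :=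
  NormedSpace.exp (-(d • leaderLaplacian W G S))

/-- The convergence error bound of the leader set `S` for a fixed topology over an interval
of length `d`:
`∑_{i ∉ S} [∑_{j ∉ S} P_ij ^ p + (1 - ∑_{j ∈ S} P_ij) ^ p]` with `P = exp (-L d)`. -/
def convergenceError {n : ℕ} (p : ℝ) (W : Matrix (Fin n) (Fin n) ℝ) (G : NetTopology n) (d : ℝ)
    (S : Finset (Fin n)) : ℝ :=
  ∑ i ∈ Sᶜ, (∑ j ∈ Sᶜ, transitionMatrix W G d S i j ^ p
    + (1 - ∑ j ∈ S, transitionMatrix W G d S i j) ^ p)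

/-- The average over the `r` epochs of the convergence error bound of the leader sets
`S 0, …, S (r-1)`; epoch `m` has weights `W m`, topology `G m` and length `δ m`. -/
def dynamicError {n k r : ℕ} (p : ℝ) (W : Fin r → Matrix (Fin n) (Fin n) ℝ) (δ : Fin r → ℝ)
    (G : Fin r → NetTopology n) (S : Fin r → LeaderSet n k) : ℝ :=
  (1 / (r : ℝ)) * ∑ m, convergenceError p (W m) (G m) (δ m) (S m).1

/-- The regret of a sequence of leader sets: its error minus the least error of a fixed
leader set with at most `k` elements. -/
def regret {n k r : ℕ} (p : ℝ) (W : Fin r → Matrix (Fin n) (Fin n) ℝ) (δ : Fin r → ℝ)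
    (G : Fin r → NetTopology n) (S : Fin r → LeaderSet n k) : ℝ :=
  dynamicError p W δ G S - ⨅ T : LeaderSet n k, dynamicError p W δ G fun _ => T

/-- A deterministic leader selection algorithm without topology knowledge: the leader set of
epoch `m` is a function of the topologies of the epochs before `m` only. -/
abbrev OnlineAlgorithm (n k r : ℕ) : Type :=
  (m : Fin r) → (Fin (m : ℕ) → NetTopology n) → LeaderSet n k

/-- The leader sets chosen by an algorithm on a sequence of topologies. -/
def OnlineAlgorithm.run {n k r : ℕ} (a : OnlineAlgorithm n k r) (G : Fin r → NetTopology n) :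
    Fin r → LeaderSet n k :=
  fun m => a m fun l => G ⟨l, l.2.trans m.2⟩

/-- A possibly randomized leader selection algorithm: its random choices are drawn independently
of the topologies. -/
abbrev RandomizedAlgorithm (n k r : ℕ) : Type :=
  PMF (OnlineAlgorithm n k r)

/-- Expectation of a real function under a distribution on a finite type. -/
def finExpect {α : Type*} [Fintype α] (μ : PMF α) (f : α → ℝ) : ℝ :=
  ∑ a, (μ a).toReal * f a

/-- The regret on a given sequence of topologies, in expectation over the algorithm's own
randomness. -/
def expectedRegret {n k r : ℕ} (p : ℝ) (W : Fin r → Matrix (Fin n) (Fin n) ℝ) (δ : Fin r → ℝ)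
    (μ : RandomizedAlgorithm n k r) (G : Fin r → NetTopology n) : ℝ :=
  finExpect μ fun a => regret p W δ G (OnlineAlgorithm.run a G)

/-- The topology in which each node `i` with `b i = true` is connected to all other nodes
(every other node uses the state of `i`), and each node with `b i = false` to none. -/
def broadcastTopology {n : ℕ} (b : Fin n → Bool) : NetTopology n :=
  ⟨fun j => Finset.univ.filter fun i => i ≠ j ∧ b i = true, fun j => by simp⟩

/-- The random topology sequence in which, independently over all nodes and all epochs, each
node is connected to all other nodes with probability `1/2` and to none with
probability `1/2`. -/
def coinTopologies (n r : ℕ) : PMF (Fin r → NetTopology n) :=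
  (PMF.uniformOfFintype (Fin r → Fin n → Bool)).map fun b m => broadcastTopology (b m)

end

/-! Two fixed leader sets `{a}` and `{b}` already force the bound. Draw the topologies independently
over the epochs, from laws under which both sets minimise the expected error in every epoch. An
algorithm that has not seen the current topology then does no better in expectation than the average
of the two, while in hindsight the better of them beats that average by half of |∑ D_m|, where D_m
is the difference of their errors in epoch m (`le_productExpect_regret`). The D_m are independent,
centred, at most 2n in modulus and have second moment of order at least n², so a fourth-moment bound
gives E|∑ D_m| of order at least n√r (`le_productExpect_abs_sum`). For large n this exceeds √(r ln n
/ 2) for every r ≥ 1; no maximum over n leaders is needed.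

For arbitrary weights, each epoch mixes two hub topologies, in which all nodes but a and b listen
only to a, or only to b. The hub is the best leader, and no other choice beats the isolated one of
the two nodes. Mixing with probabilities inversely proportional to the two gaps makes both optimal
(`exists_balanced_hub_mixture`), and some realisation does at least as badly as the mean.

For equal weights, the law of the coin topologies is invariant under relabelling nodes, so all
singletons have the same expected error, and the empty set is no better. With probability 1/2
exactly one of a, b broadcasts, and then their errors differ by order n
(`le_sum_broadcastError_sub_sq`). In both constructions the matrix exponential is read off from
eigenvectors of the Laplacian. -/

open scoped BigOperators Matrix

/-! ### Moments of independent sums under product weights. -/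

/-- The weight of `x` under the product of the weights `q i`. -/
noncomputable def productWeight {ι Ω : Type*} [Fintype ι] (q : ι → Ω → ℝ) (x : ι → Ω) : ℝ :=
  ∏ i, q i (x i)

/-- Expectation of `F` under the product of the weights `q i`. -/
noncomputable def productExpect {ι Ω : Type*} [Fintype ι] [DecidableEq ι] [Fintype Ω]
    (q : ι → Ω → ℝ) (F : (ι → Ω) → ℝ) : ℝ :=
  ∑ x, productWeight q x * F x

lemma productWeight_nonneg {ι Ω : Type*} [Fintype ι] {q : ι → Ω → ℝ}
    (hq : ∀ i x, 0 ≤ q i x) (x : ι → Ω) : 0 ≤ productWeight q x :=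
  Finset.prod_nonneg fun i _ => hq i _

/-- Exchanging a coordinate with a fresh independent copy preserves the joint weight. The multiplied
form avoids dividing by `q m (x m)`, which may vanish. -/
lemma productWeight_mul_update {ι Ω : Type*} [Fintype ι] [DecidableEq ι] (q : ι → Ω → ℝ)
    (m : ι) (x : ι → Ω) (y : Ω) :
    productWeight q (Function.update x m y) * q m (x m) = productWeight q x * q m y := by
  unfold productWeight
  rw [← Finset.mul_prod_erase _ _ (Finset.mem_univ m),
    ← Finset.mul_prod_erase Finset.univ (fun i => q i (x i)) (Finset.mem_univ m)]
  have : ∏ i ∈ Finset.univ.erase m, q i (Function.update x m y i) =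
      ∏ i ∈ Finset.univ.erase m, q i (x i) :=
    Finset.prod_congr rfl fun i hi => by
      rw [Function.update_of_ne (Finset.ne_of_mem_erase hi)]
  rw [this, Function.update_self]
  ring

lemma sum_update_of_notMem {ι Ω : Type*} [DecidableEq ι] (D : ι → Ω → ℝ) {m : ι}
    {s : Finset ι} (hm : m ∉ s) (x : ι → Ω) (y : Ω) :
    ∑ i ∈ s, D i (Function.update x m y i) = ∑ i ∈ s, D i (x i) :=
  Finset.sum_congr rfl fun i hi => by
    rw [Function.update_of_ne (ne_of_mem_of_not_mem hi hm)]

section ProductExpect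

variable {ι Ω : Type*} [Fintype ι] [DecidableEq ι] [Fintype Ω] {q : ι → Ω → ℝ}

lemma sum_productWeight (hq : ∀ i, ∑ x, q i x = 1) : ∑ x, productWeight q x = 1 := by
  have h := Finset.prod_univ_sum (fun _ : ι => (Finset.univ : Finset Ω)) q
  simp only [hq, Finset.prod_const_one, Fintype.piFinset_univ] at h
  exact h.symm

/-- Averaging over one coordinate does not change the expectation. -/
lemma productExpect_update (hq : ∀ i, ∑ x, q i x = 1) (m : ι) (F : (ι → Ω) → ℝ) :
    productExpect q (fun x => ∑ y, q m y * F (Function.update x m y)) = productExpect q F := by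
  -- Resampling is a swap of coordinate `m` with the fresh value, a weight-preserving involution.
  have hinv : Function.Involutive
      (fun z : (ι → Ω) × Ω => (Function.update z.1 m z.2, z.1 m)) := by
    rintro ⟨x, y⟩
    simp
  calc productExpect q (fun x => ∑ y, q m y * F (Function.update x m y))
      = ∑ z : (ι → Ω) × Ω, productWeight q z.1 * q m z.2 * F (Function.update z.1 m z.2) := by
        rw [Fintype.sum_prod_type]
        simp only [productExpect, Finset.mul_sum, mul_assoc]
    _ = ∑ z : (ι → Ω) × Ω, productWeight q z.1 * q m z.2 * F z.1 := by
        rw [← Equiv.sum_comp hinv.toPerm]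
        refine Finset.sum_congr rfl fun z _ => ?_
        simp [productWeight_mul_update]
    _ = productExpect q F := by
        rw [Fintype.sum_prod_type]
        refine Finset.sum_congr rfl fun x _ => ?_
        simp only
        rw [← Finset.sum_mul, ← Finset.mul_sum, hq, mul_one]

lemma productExpect_add (F G : (ι → Ω) → ℝ) :
    productExpect q (fun x => F x + G x) = productExpect q F + productExpect q G := by
  simp only [productExpect, mul_add, Finset.sum_add_distrib]

lemma productExpect_const_mul (c : ℝ) (F : (ι → Ω) → ℝ) :
    productExpect q (fun x => c * F x) = c * productExpect q F := by
  simp only [productExpect, Finset.mul_sum, mul_left_comm]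

lemma productExpect_const (hq : ∀ i, ∑ x, q i x = 1) (c : ℝ) :
    productExpect q (fun _ => c) = c := by
  simp only [productExpect]
  rw [← Finset.sum_mul, sum_productWeight hq, one_mul]

lemma productExpect_sum {κ : Type*} (s : Finset κ) (F : κ → (ι → Ω) → ℝ) :
    productExpect q (fun x => ∑ k ∈ s, F k x) = ∑ k ∈ s, productExpect q (F k) := by
  simp only [productExpect, Finset.mul_sum]
  exact Finset.sum_comm

lemma productExpect_mono (hq : ∀ i x, 0 ≤ q i x) {F G : (ι → Ω) → ℝ} (h : ∀ x, F x ≤ G x) :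
    productExpect q F ≤ productExpect q G :=
  Finset.sum_le_sum fun x _ => mul_le_mul_of_nonneg_left (h x) (productWeight_nonneg hq x)

/-- Expectation of a function of a single coordinate. -/
lemma productExpect_coord (hq : ∀ i, ∑ x, q i x = 1) (m : ι) (f : Ω → ℝ) :
    productExpect q (fun x => f (x m)) = ∑ y, q m y * f y := by
  rw [← productExpect_update hq m]
  simp only [Function.update_self]
  exact productExpect_const hq _

variable (D : ι → Ω → ℝ)

lemma productExpect_sum_eq_zero (hq : ∀ i, ∑ x, q i x = 1)
    (hD : ∀ i, ∑ x, q i x * D i x = 0) (s : Finset ι) :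
    productExpect q (fun x => ∑ i ∈ s, D i (x i)) = 0 := by
  rw [productExpect_sum]
  exact Finset.sum_eq_zero fun i _ => by rw [productExpect_coord hq i, hD]

lemma productExpect_sum_sq (hq : ∀ i, ∑ x, q i x = 1)
    (hD : ∀ i, ∑ x, q i x * D i x = 0) (s : Finset ι) :
    productExpect q (fun x => (∑ i ∈ s, D i (x i)) ^ 2) =
      ∑ i ∈ s, ∑ x, q i x * D i x ^ 2 := by
  induction s using Finset.induction_on with
  | empty => simp [productExpect]
  | insert m s hm ih =>
    rw [← productExpect_update hq m, Finset.sum_insert hm, ← ih]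
    have h : ∀ x : ι → Ω, ∑ y, q m y *
        (∑ i ∈ insert m s, D i (Function.update x m y i)) ^ 2 =
        (∑ y, q m y * D m y ^ 2) + (∑ i ∈ s, D i (x i)) ^ 2 := by
      intro x
      simp only [Finset.sum_insert hm, Function.update_self, sum_update_of_notMem D hm]
      generalize ∑ i ∈ s, D i (x i) = a
      calc ∑ y, q m y * (D m y + a) ^ 2
          = ∑ y, (q m y * D m y ^ 2 + (2 * a) * (q m y * D m y) + q m y * a ^ 2) :=
            Finset.sum_congr rfl fun y _ => by ring
        _ = _ := by
            rw [Finset.sum_add_distrib, Finset.sum_add_distrib, ← Finset.mul_sum,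
              ← Finset.sum_mul, hD, hq]
            ring
    simp only [h]
    rw [productExpect_add, productExpect_const hq]

/-- Induction on the number of summands: averaging over the new coordinate kills the terms linear in
the new summand, and the cubic one dies because the old sum is centred. The term 6vV comes from
expanding 3(V + v)². -/
lemma productExpect_sum_pow_four_le (hq0 : ∀ i x, 0 ≤ q i x) (hq : ∀ i, ∑ x, q i x = 1)
    (hD : ∀ i, ∑ x, q i x * D i x = 0) {B : ℝ} (hB : ∀ i x, |D i x| ≤ B) (s : Finset ι) :
    productExpect q (fun x => (∑ i ∈ s, D i (x i)) ^ 4) ≤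
      3 * (∑ i ∈ s, ∑ x, q i x * D i x ^ 2) ^ 2 + B ^ 2 * ∑ i ∈ s, ∑ x, q i x * D i x ^ 2 := by
  induction s using Finset.induction_on with
  | empty => simp [productExpect]
  | insert m s hm ih =>
    rw [← productExpect_update hq m, Finset.sum_insert hm]
    have h : ∀ x : ι → Ω, ∑ y, q m y *
        (∑ i ∈ insert m s, D i (Function.update x m y i)) ^ 4 =
        ((∑ y, q m y * D m y ^ 4) + (4 * ∑ y, q m y * D m y ^ 3) * (∑ i ∈ s, D i (x i))) +
        ((6 * ∑ y, q m y * D m y ^ 2) * (∑ i ∈ s, D i (x i)) ^ 2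
          + (∑ i ∈ s, D i (x i)) ^ 4) := by
      intro x
      simp only [Finset.sum_insert hm, Function.update_self, sum_update_of_notMem D hm]
      generalize ∑ i ∈ s, D i (x i) = a
      calc ∑ y, q m y * (D m y + a) ^ 4
          = ∑ y, (q m y * D m y ^ 4 + (4 * a) * (q m y * D m y ^ 3)
              + (6 * a ^ 2) * (q m y * D m y ^ 2) + (4 * a ^ 3) * (q m y * D m y)
              + q m y * a ^ 4) :=
            Finset.sum_congr rfl fun y _ => by ring
        _ = _ := by
            simp only [Finset.sum_add_distrib, ← Finset.mul_sum, ← Finset.sum_mul, hD, hq]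
            ring
    simp only [h]
    rw [productExpect_add, productExpect_add, productExpect_add, productExpect_const hq,
      productExpect_const_mul, productExpect_const_mul, productExpect_sum_eq_zero D hq hD,
      productExpect_sum_sq D hq hD]
    have h4 : ∑ y, q m y * D m y ^ 4 ≤ B ^ 2 * ∑ y, q m y * D m y ^ 2 := by
      rw [Finset.mul_sum]
      refine Finset.sum_le_sum fun y _ => ?_
      have : D m y ^ 2 ≤ B ^ 2 := sq_le_sq' (by linarith [neg_abs_le (D m y), hB m y])
        ((le_abs_self _).trans (hB m y))
      nlinarith [mul_nonneg (hq0 m y) (sq_nonneg (D m y))]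
    nlinarith [sq_nonneg (∑ y, q m y * D m y ^ 2)]

lemma sq_div_sub_pow_four_div_le_abs {s : ℝ} (hs : 0 < s) (x : ℝ) :
    s⁻¹ * x ^ 2 + -(s⁻¹ ^ 3 / 4) * x ^ 4 ≤ |x| := by
  -- The case s = 1; the general case is its rescaling y = |x| / s.
  have hy : ∀ y : ℝ, 0 ≤ y → y ^ 2 - y ^ 4 / 4 ≤ y := by
    intro y hy
    have : 0 ≤ 1 - y + y ^ 3 / 4 := by nlinarith [mul_nonneg hy (sq_nonneg (y - 1)), sq_nonneg (y - 1)]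
    nlinarith
  have h := hy (s⁻¹ * |x|) (by positivity)
  have h2 : |x| ^ 4 = x ^ 4 := by rw [← abs_pow, abs_of_nonneg (by positivity)]
  have h3 := mul_le_mul_of_nonneg_left h hs.le
  rw [mul_pow, mul_pow, sq_abs, h2, mul_inv_cancel_left₀ hs.ne'] at h3
  refine le_of_eq_of_le ?_ h3
  field_simp
  ring

/-- The first absolute moment of a sum of bounded independent centred variables with variance at
least `v` is of the order of the square root of the number of summands. -/
lemma le_productExpect_abs_sum [Nonempty ι] (hq0 : ∀ i x, 0 ≤ q i x) (hq : ∀ i, ∑ x, q i x = 1)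
    (hD : ∀ i, ∑ x, q i x * D i x = 0) {N v : ℝ} (hN : 0 < N) (hB : ∀ i x, |D i x| ≤ 2 * N)
    (hv : ∀ i, v ≤ ∑ x, q i x * D i x ^ 2) :
    3 / 16 * (v / N) * Real.sqrt (Fintype.card ι) ≤
      productExpect q (fun x => |∑ i, D i (x i)|) := by
  have hc : (1 : ℝ) ≤ Fintype.card ι := by exact_mod_cast Fintype.card_pos
  set R : ℝ := (Fintype.card ι : ℝ) with hR
  have ht : 0 < Real.sqrt R := Real.sqrt_pos.2 (by linarith)
  have ht2 : Real.sqrt R ^ 2 = R := Real.sq_sqrt (by linarith)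
  set t := Real.sqrt R with ht_def
  set V := ∑ i, ∑ x, q i x * D i x ^ 2 with hV
  have hVlo : R * v ≤ V := by
    have := Finset.card_nsmul_le_sum Finset.univ (fun i => ∑ x, q i x * D i x ^ 2) v
      fun i _ => hv i
    simpa [hR] using this
  have hVhi : V ≤ R * (4 * N ^ 2) := by
    have h : ∀ i ∈ Finset.univ, ∑ x, q i x * D i x ^ 2 ≤ 4 * N ^ 2 := by
      intro i _
      calc ∑ x, q i x * D i x ^ 2 ≤ ∑ x, q i x * (4 * N ^ 2) := by
            refine Finset.sum_le_sum fun x _ => mul_le_mul_of_nonneg_left ?_ (hq0 i x)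
            have := abs_le.1 (hB i x)
            nlinarith
        _ = 4 * N ^ 2 := by rw [← Finset.sum_mul, hq, one_mul]
    have := Finset.sum_le_card_nsmul Finset.univ _ _ h
    simpa [hR] using this
  have hV0 : 0 ≤ V := Finset.sum_nonneg fun i _ => Finset.sum_nonneg fun x _ =>
    mul_nonneg (hq0 i x) (sq_nonneg _)
  -- The scale s = 4N√R satisfies 3V + (2N)² ≤ s², so the fourth moment is at most s²V. The quartic
  -- correction then costs at most a quarter of V/s, which leaves (3/4)V/s.
  have hs : 0 < 4 * N * t := by positivity
  have h1 := productExpect_mono hq0 (fun x => sq_div_sub_pow_four_div_le_abs hs (∑ i, D i (x i)))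
  rw [productExpect_add, productExpect_const_mul, productExpect_const_mul,
    productExpect_sum_sq D hq hD] at h1
  have h4 := productExpect_sum_pow_four_le D hq0 hq hD hB Finset.univ
  rw [← hV] at h1 h4
  refine le_trans ?_ h1
  have h5 : (4 * N * t)⁻¹ ^ 3 / 4 * productExpect q (fun x => (∑ i, D i (x i)) ^ 4) ≤
      (4 * N * t)⁻¹ ^ 3 / 4 * ((4 * N * t) ^ 2 * V) := by
    refine mul_le_mul_of_nonneg_left (h4.trans ?_) (by positivity)
    have : 3 * V + (2 * N) ^ 2 ≤ (4 * N * t) ^ 2 := by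
      rw [mul_pow (4 * N), ht2]
      nlinarith [mul_nonneg (sub_nonneg.2 hc) (sq_nonneg N)]
    nlinarith
  have h6 : (4 * N * t)⁻¹ ^ 3 / 4 * ((4 * N * t) ^ 2 * V) = (4 * N * t)⁻¹ * V / 4 := by
    field_simp
  have h7 : 3 / 16 * (v / N) * t = 3 / 4 * ((4 * N * t)⁻¹ * (R * v)) := by
    rw [← ht2]
    field_simp
    ring
  have h8 : (4 * N * t)⁻¹ * (R * v) ≤ (4 * N * t)⁻¹ * V :=
    mul_le_mul_of_nonneg_left hVlo (by positivity)
  rw [h7]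
  linarith

end ProductExpect

/-! ### Regret against a pair of leader sets. -/

lemma regret_ge_of_pair {n k r : ℕ} (p : ℝ) (W : Fin r → Matrix (Fin n) (Fin n) ℝ)
    (δ : Fin r → ℝ) (G : Fin r → NetTopology n) (S : Fin r → LeaderSet n k) (A B : LeaderSet n k) :
    1 / (r : ℝ) * ((∑ m, (convergenceError p (W m) (G m) (δ m) (S m).1
        - (convergenceError p (W m) (G m) (δ m) A.1
          + convergenceError p (W m) (G m) (δ m) B.1) / 2))
      + |∑ m, (convergenceError p (W m) (G m) (δ m) A.1
          - convergenceError p (W m) (G m) (δ m) B.1)| / 2) ≤ regret p W δ G S := by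
  have hinf : ∀ T : LeaderSet n k, ⨅ T : LeaderSet n k, (dynamicError p W δ G fun _ => T) ≤
      dynamicError p W δ G fun _ => T := fun T => ciInf_le (Set.finite_range _).bddBelow T
  have hA := hinf A
  have hB := hinf B
  unfold regret
  set I := ⨅ T : LeaderSet n k, (dynamicError p W δ G fun _ => T)
  unfold dynamicError at hA hB ⊢
  rw [Finset.sum_sub_distrib, ← Finset.sum_div, Finset.sum_add_distrib, Finset.sum_sub_distrib]
  have hr : (0 : ℝ) ≤ 1 / r := by positivity
  -- The minimum of two numbers is their mean minus half their distance; the sign decides which of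
  -- `A`, `B` bounds the infimum.
  rcases abs_cases (∑ m, convergenceError p (W m) (G m) (δ m) A.1
      - ∑ m, convergenceError p (W m) (G m) (δ m) B.1) with ⟨h, -⟩ | ⟨h, -⟩ <;> rw [h] <;>
    nlinarith

/-- If the topologies are independent and in every epoch the leader sets `A` and `B` are both optimal
in expectation, then any algorithm suffers the expected fluctuation of the difference of their
errors. -/
lemma le_productExpect_regret {n k r : ℕ} (hr : 0 < r) {p : ℝ}
    {W : Fin r → Matrix (Fin n) (Fin n) ℝ} {δ : Fin r → ℝ} {Ω : Type*} [Fintype Ω]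
    {q : Fin r → Ω → ℝ} (hq0 : ∀ m x, 0 ≤ q m x) (hq : ∀ m, ∑ x, q m x = 1)
    (T : Fin r → Ω → NetTopology n) (A B : LeaderSet n k)
    (hA : ∀ m (S : LeaderSet n k),
      ∑ x, q m x * convergenceError p (W m) (T m x) (δ m) A.1 ≤
        ∑ x, q m x * convergenceError p (W m) (T m x) (δ m) S.1)
    (hB : ∀ m (S : LeaderSet n k),
      ∑ x, q m x * convergenceError p (W m) (T m x) (δ m) B.1 ≤
        ∑ x, q m x * convergenceError p (W m) (T m x) (δ m) S.1)
    {N v : ℝ} (hN : 0 < N)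
    (hbound : ∀ m x, |convergenceError p (W m) (T m x) (δ m) A.1
      - convergenceError p (W m) (T m x) (δ m) B.1| ≤ 2 * N)
    (hv : ∀ m, v ≤ ∑ x, q m x * (convergenceError p (W m) (T m x) (δ m) A.1
      - convergenceError p (W m) (T m x) (δ m) B.1) ^ 2)
    (a : OnlineAlgorithm n k r) :
    1 / (r : ℝ) * (3 / 32 * (v / N) * Real.sqrt r) ≤
      productExpect q fun x => regret p W δ (fun m => T m (x m))
        (OnlineAlgorithm.run a fun m => T m (x m)) := by
  have : Nonempty (Fin r) := ⟨⟨0, hr⟩⟩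
  have hD : ∀ m, ∑ x, q m x * (convergenceError p (W m) (T m x) (δ m) A.1
      - convergenceError p (W m) (T m x) (δ m) B.1) = 0 := by
    intro m
    simp only [mul_sub, Finset.sum_sub_distrib]
    -- Two minimisers have the same expected error, so the difference is centred.
    linarith [hA m B, hB m A]
  have habs := le_productExpect_abs_sum (fun m x => convergenceError p (W m) (T m x) (δ m) A.1
      - convergenceError p (W m) (T m x) (δ m) B.1) hq0 hq hD hN hbound hv
  rw [Fintype.card_fin] at habs
  have hmono := productExpect_mono hq0 (fun x : Fin r → Ω => regret_ge_of_pair p W δ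
    (fun m => T m (x m)) (OnlineAlgorithm.run a fun m => T m (x m)) A B)
  refine le_trans ?_ hmono
  rw [productExpect_const_mul]
  refine mul_le_mul_of_nonneg_left ?_ (by positivity)
  simp only [div_eq_inv_mul _ (2 : ℝ)]
  rw [productExpect_add, productExpect_const_mul, productExpect_sum]
  have hpos : 0 ≤ ∑ m, productExpect q (fun x : Fin r → Ω =>
      convergenceError p (W m) (T m (x m)) (δ m) (OnlineAlgorithm.run a (fun m => T m (x m)) m).1
        - 2⁻¹ * (convergenceError p (W m) (T m (x m)) (δ m) A.1
          + convergenceError p (W m) (T m (x m)) (δ m) B.1)) := by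
    refine Finset.sum_nonneg fun m _ => ?_
    rw [← productExpect_update hq m]
    refine Finset.sum_nonneg fun x _ => mul_nonneg (productWeight_nonneg hq0 x) ?_
    -- The choice in epoch `m` ignores the topology of epoch `m`, so it stays fixed while that
    -- topology is resampled and optimality of `A` and `B` applies to it.
    have hrun : ∀ y, OnlineAlgorithm.run a (fun l => T l (Function.update x m y l)) m =
        OnlineAlgorithm.run a (fun l => T l (x l)) m := by
      intro y
      unfold OnlineAlgorithm.run
      congr 1
      funext l
      dsimp only
      rw [Function.update_of_ne]
      exact fun h => absurd (congrArg Fin.val h) l.2.ne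
    simp only [hrun, Function.update_self]
    generalize OnlineAlgorithm.run a (fun l => T l (x l)) m = S
    have h := hA m S
    have h' := hB m S
    have heq : ∑ y, q m y * (convergenceError p (W m) (T m y) (δ m) S.1
        - 2⁻¹ * (convergenceError p (W m) (T m y) (δ m) A.1
          + convergenceError p (W m) (T m y) (δ m) B.1)) =
        ∑ y, q m y * convergenceError p (W m) (T m y) (δ m) S.1
        - 2⁻¹ * (∑ y, q m y * convergenceError p (W m) (T m y) (δ m) A.1
          + ∑ y, q m y * convergenceError p (W m) (T m y) (δ m) B.1) := by
      rw [← Finset.sum_add_distrib, Finset.mul_sum, ← Finset.sum_sub_distrib]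
      exact Finset.sum_congr rfl fun y _ => by ring
    rw [heq]
    linarith
  linarith

/-! ### Randomized algorithms and random topologies. -/

lemma sum_toReal_pmf {α : Type*} [Fintype α] (μ : PMF α) : ∑ a, (μ a).toReal = 1 := by
  rw [← ENNReal.toReal_sum fun a _ => μ.apply_ne_top a, ← tsum_fintype (L := .unconditional _), μ.tsum_coe,
    ENNReal.toReal_one]

/-- A randomized algorithm is a mixture of deterministic ones drawn independently of the topologies,
so the two expectations commute. -/
lemma le_productExpect_expectedRegret {n k r : ℕ} {p : ℝ}
    {W : Fin r → Matrix (Fin n) (Fin n) ℝ} {δ : Fin r → ℝ} {Ω : Type*} [Fintype Ω]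
    {q : Fin r → Ω → ℝ} {T : Fin r → Ω → NetTopology n} {c : ℝ}
    (h : ∀ a : OnlineAlgorithm n k r, c ≤
      productExpect q fun x => regret p W δ (fun m => T m (x m))
        (OnlineAlgorithm.run a fun m => T m (x m))) (μ : RandomizedAlgorithm n k r) :
    c ≤ productExpect q fun x => expectedRegret p W δ μ fun m => T m (x m) := by
  unfold expectedRegret finExpect
  rw [productExpect_sum]
  simp only [productExpect_const_mul]
  calc c = ∑ a, (μ a).toReal * c := by rw [← Finset.sum_mul, sum_toReal_pmf, one_mul]
    _ ≤ _ := Finset.sum_le_sum fun a _ => mul_le_mul_of_nonneg_left (h a) ENNReal.toReal_nonneg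

lemma exists_le_of_le_productExpect {ι Ω : Type*} [Fintype ι] [DecidableEq ι] [Fintype Ω]
    {q : ι → Ω → ℝ} (hq0 : ∀ i x, 0 ≤ q i x) (hq : ∀ i, ∑ x, q i x = 1) {F : (ι → Ω) → ℝ} {c : ℝ}
    (h : c ≤ productExpect q F) : ∃ x, c ≤ F x := by
  by_contra! hF
  have hsum : ∑ x, productWeight q x * F x < ∑ x, productWeight q x * c := by
    refine Finset.sum_lt_sum (fun x _ => mul_le_mul_of_nonneg_left (hF x).le
      (productWeight_nonneg hq0 x)) ?_
    obtain ⟨x, -, hx⟩ := Finset.exists_ne_zero_of_sum_ne_zero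
      (s := Finset.univ) (f := productWeight q) (by rw [sum_productWeight hq]; exact one_ne_zero)
    exact ⟨x, Finset.mem_univ x, mul_lt_mul_of_pos_left (hF x)
      (lt_of_le_of_ne (productWeight_nonneg hq0 x) hx.symm)⟩
  rw [← Finset.sum_mul, sum_productWeight hq, one_mul] at hsum
  exact absurd h (not_le.2 hsum)

lemma finExpect_map {α β : Type*} [Fintype α] [Fintype β] (μ : PMF α) (f : α → β) (F : β → ℝ) :
    finExpect (μ.map f) F = ∑ a, (μ a).toReal * F (f a) := by
  classical
  unfold finExpect
  have h : ∀ b, ((μ.map f) b).toReal = ∑ a, if b = f a then (μ a).toReal else 0 := by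
    intro b
    rw [PMF.map_apply, tsum_fintype, ENNReal.toReal_sum]
    · exact Finset.sum_congr rfl fun a _ => by split_ifs <;> simp
    · intro a _
      split_ifs
      exacts [μ.apply_ne_top a, ENNReal.zero_ne_top]
  simp only [h, Finset.sum_mul, ite_mul, zero_mul]
  rw [Finset.sum_comm]
  simp

lemma finExpect_coinTopologies (n r : ℕ) (F : (Fin r → NetTopology n) → ℝ) :
    finExpect (coinTopologies n r) F =
      productExpect (fun _ _ => ((Fintype.card (Fin n → Bool) : ℝ))⁻¹)
        fun b : Fin r → Fin n → Bool => F fun m => broadcastTopology (b m) := by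
  unfold coinTopologies productExpect productWeight
  rw [finExpect_map]
  simp

/-! ### Transition matrices from eigenvectors. -/

section
open scoped Matrix.Norms.Operator Matrix

lemma exp_mulVec_of_mulVec_eq_smul {ι : Type*} [Fintype ι] [DecidableEq ι] {A : Matrix ι ι ℝ}
    {v : ι → ℝ} {a : ℝ} (h : A *ᵥ v = a • v) :
    NormedSpace.exp A *ᵥ v = Real.exp a • v := by
  have hpow : ∀ k : ℕ, (A ^ k) *ᵥ v = a ^ k • v := by
    intro k
    induction k with
    | zero => simp
    | succ k ih => rw [pow_succ, ← Matrix.mulVec_mulVec, h, Matrix.mulVec_smul, ih, smul_smul, pow_succ']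
  have h1 := (NormedSpace.exp_series_hasSum_exp' (𝕂 := ℝ) A).map
    (⟨⟨fun M => M *ᵥ v, Matrix.zero_mulVec v⟩, fun M N => Matrix.add_mulVec M N v⟩ :
      Matrix ι ι ℝ →+ (ι → ℝ)) (continuous_id.matrix_mulVec continuous_const)
  have h2 := (NormedSpace.exp_series_hasSum_exp' (𝕂 := ℝ) a).smul_const v
  rw [← Real.exp_eq_exp_ℝ] at h2
  refine h1.unique ?_
  convert h2 using 2 with k
  simp [Matrix.smul_mulVec, hpow, smul_smul]

end

lemma transitionMatrix_mulVec_of_eigen {n : ℕ} {W : Matrix (Fin n) (Fin n) ℝ} {G : NetTopology n}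
    {S : Finset (Fin n)} {v : Fin n → ℝ} {a : ℝ} (d : ℝ)
    (h : leaderLaplacian W G S *ᵥ v = a • v) :
    transitionMatrix W G d S *ᵥ v = Real.exp (-(d * a)) • v := by
  refine exp_mulVec_of_mulVec_eq_smul ?_
  rw [Matrix.neg_mulVec, Matrix.smul_mulVec, h, smul_smul, neg_smul]

lemma leaderLaplacian_mulVec {n : ℕ} (W : Matrix (Fin n) (Fin n) ℝ) (G : NetTopology n)
    (S : Finset (Fin n)) (v : Fin n → ℝ) (i : Fin n) :
    (leaderLaplacian W G S *ᵥ v) i =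
      if i ∈ S then 0 else ∑ l ∈ G.1 i, W i l * (v i - v l) := by
  unfold Matrix.mulVec dotProduct leaderLaplacian
  simp only [Matrix.of_apply]
  split_ifs with hi
  · simp
  · have h : ∀ j, (if i = j then ∑ l ∈ G.1 i, W i l else if j ∈ G.1 i then -W i j else 0) * v j =
        (if i = j then (∑ l ∈ G.1 i, W i l) * v j else 0)
          - (if j ∈ G.1 i then W i j * v j else 0) := by
      intro j
      by_cases hij : i = j
      · subst hij
        simp [G.2 i]
      · simp only [hij, if_false]
        split_ifs <;> ring
    simp only [h]
    rw [Finset.sum_sub_distrib, Finset.sum_ite_eq, if_pos (Finset.mem_univ i),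
      Finset.sum_ite_mem, Finset.univ_inter, Finset.sum_mul, ← Finset.sum_sub_distrib]
    exact Finset.sum_congr rfl fun l _ => by ring

/-- The constant vector lies in the kernel of the Laplacian. -/
lemma sum_transitionMatrix {n : ℕ} (W : Matrix (Fin n) (Fin n) ℝ) (G : NetTopology n) (d : ℝ)
    (S : Finset (Fin n)) (i : Fin n) : ∑ j, transitionMatrix W G d S i j = 1 := by
  have h : leaderLaplacian W G S *ᵥ (fun _ => (1 : ℝ)) = (0 : ℝ) • fun _ => (1 : ℝ) := by
    funext i
    rw [leaderLaplacian_mulVec]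
    simp
  have h2 := congrFun (transitionMatrix_mulVec_of_eigen d h) i
  simpa [Matrix.mulVec, dotProduct] using h2

lemma transitionMatrix_apply_of_eigen_single {n : ℕ} {W : Matrix (Fin n) (Fin n) ℝ}
    {G : NetTopology n} {S : Finset (Fin n)} {j : Fin n} {a : ℝ} (d : ℝ)
    (h : leaderLaplacian W G S *ᵥ Pi.single j 1 = a • Pi.single j (1 : ℝ)) (i : Fin n) :
    transitionMatrix W G d S i j = if i = j then Real.exp (-(d * a)) else 0 := by
  have h2 := congrFun (transitionMatrix_mulVec_of_eigen d h) i
  rw [Matrix.mulVec_single_one] at h2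
  simpa [Pi.single_apply] using h2

lemma rpow_le_self_of_mem_unit {x p : ℝ} (h0 : 0 ≤ x) (h1 : x ≤ 1) (hp : 1 ≤ p) : x ^ p ≤ x := by
  simpa using Real.rpow_le_rpow_of_exponent_ge_of_imp h0 h1 hp (by intro _ h; linarith)

/-! ### Hub topologies. -/

/-- The topology in which every node other than `a` and `b` uses exactly the state of `a`. -/
def hubTopology {n : ℕ} (a b : Fin n) : NetTopology n :=
  ⟨fun j => if j = a ∨ j = b then ∅ else {a}, fun j => by
    dsimp only
    split_ifs with h
    · simp
    · simpa using fun hj => h (Or.inl hj)⟩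

section HubTopology

variable {n : ℕ} (W : Matrix (Fin n) (Fin n) ℝ) (a b : Fin n) (d : ℝ) (S : Finset (Fin n))

/-- Nobody listens to `j ≠ a`, so the basis vector at `j` is an eigenvector. The remaining column
`a` follows from the row sums. -/
lemma transitionMatrix_hub_of_ne (i : Fin n) {j : Fin n} (hj : j ≠ a) :
    transitionMatrix W (hubTopology a b) d S i j =
      if i = j then Real.exp (-(d * if j ∈ S ∨ j = a ∨ j = b then 0 else W j a)) else 0 := by
  refine transitionMatrix_apply_of_eigen_single d ?_ i
  funext k
  rw [leaderLaplacian_mulVec]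
  simp only [hubTopology, Pi.smul_apply, smul_eq_mul]
  by_cases hkj : k = j
  · subst hkj
    by_cases h1 : k ∈ S <;> by_cases h2 : k = a ∨ k = b <;>
      simp [h1, h2, hj.symm]
  · by_cases h1 : k ∈ S <;> by_cases h2 : k = a ∨ k = b <;>
      simp [h1, h2, hkj, hj.symm]

lemma transitionMatrix_hub_self (i : Fin n) :
    transitionMatrix W (hubTopology a b) d S i a =
      if i = a then 1 else 1 - Real.exp (-(d * if i ∈ S ∨ i = a ∨ i = b then 0 else W i a)) := by
  have h := sum_transitionMatrix W (hubTopology a b) d S i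
  rw [← Finset.add_sum_erase _ _ (Finset.mem_univ a)] at h
  have h2 : ∑ j ∈ Finset.univ.erase a, transitionMatrix W (hubTopology a b) d S i j =
      ∑ j ∈ Finset.univ.erase a, if i = j then
        Real.exp (-(d * if i ∈ S ∨ i = a ∨ i = b then 0 else W i a)) else 0 :=
    Finset.sum_congr rfl fun j hj => by
      rw [transitionMatrix_hub_of_ne W a b d S i (Finset.ne_of_mem_erase hj)]
      split_ifs <;> simp_all
  rw [h2, Finset.sum_ite_eq] at h
  by_cases hi : i = a
  · simpa [hi] using h
  · simp only [hi, Finset.mem_erase, ne_eq, not_false_eq_true, Finset.mem_univ, and_self,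
      if_true, if_false] at h ⊢
    linarith

/-- The contribution of node `i` to the error when the hub is the leader. -/
noncomputable def hubLeaderLoss (p : ℝ) (i : Fin n) : ℝ :=
  if i = a ∨ i = b then 2 else 2 * Real.exp (-(d * W i a)) ^ p

/-- The contribution of node `i` to the error when the hub is not a leader. -/
noncomputable def hubFollowerLoss (p : ℝ) (i : Fin n) : ℝ :=
  if i = a ∨ i = b then 2
  else 1 + Real.exp (-(d * W i a)) ^ p + (1 - Real.exp (-(d * W i a))) ^ p

variable {a b}

lemma convergenceError_hub_leader {p : ℝ} (hp : 0 < p) :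
    convergenceError p W (hubTopology a b) d {a} = ∑ i ∈ {a}ᶜ, hubLeaderLoss W a b d p i := by
  unfold convergenceError
  refine Finset.sum_congr rfl fun i hi => ?_
  have hia : i ≠ a := by simpa using hi
  have h1 : ∑ j ∈ {a}ᶜ, transitionMatrix W (hubTopology a b) d {a} i j ^ p =
      Real.exp (-(d * if i = b then 0 else W i a)) ^ p := by
    rw [Finset.sum_eq_single i]
    · rw [transitionMatrix_hub_of_ne W a b d _ i hia]
      simp [hia]
    · intro j hj hji
      rw [transitionMatrix_hub_of_ne W a b d _ i (by simpa using hj), if_neg hji.symm,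
        Real.zero_rpow hp.ne']
    · exact fun h => absurd hi h
  rw [h1, Finset.sum_singleton, transitionMatrix_hub_self]
  by_cases hib : i = b
  · have hba : b ≠ a := hib ▸ hia
    norm_num [hubLeaderLoss, hib, hba]
  · simp [hubLeaderLoss, hia, hib, two_mul]

lemma convergenceError_hub_of_notMem {p : ℝ} (hp : 0 < p) (ha : a ∉ S) :
    convergenceError p W (hubTopology a b) d S = ∑ i ∈ Sᶜ, hubFollowerLoss W a b d p i := by
  unfold convergenceError
  refine Finset.sum_congr rfl fun i hi => ?_
  have hiS : i ∉ S := by simpa using hi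
  have h0 : ∑ j ∈ S, transitionMatrix W (hubTopology a b) d S i j = 0 :=
    Finset.sum_eq_zero fun j hj => by
      rw [transitionMatrix_hub_of_ne W a b d S i (ne_of_mem_of_not_mem hj ha),
        if_neg (ne_of_mem_of_not_mem hj hiS).symm]
  rw [h0, sub_zero, Real.one_rpow, ← Finset.add_sum_erase _ _ (by simpa using ha : a ∈ Sᶜ),
    transitionMatrix_hub_self]
  by_cases hia : i = a
  · rw [Finset.sum_eq_zero]
    · norm_num [hubFollowerLoss, hia]
    · intro j hj
      rw [transitionMatrix_hub_of_ne W a b d _ i (Finset.ne_of_mem_erase hj), if_neg,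
        Real.zero_rpow hp.ne']
      rintro rfl
      exact Finset.ne_of_mem_erase hj hia
  · rw [Finset.sum_eq_single i]
    · rw [transitionMatrix_hub_of_ne W a b d _ i hia]
      by_cases hib : i = b
      · norm_num [hubFollowerLoss, hiS, hia, hib, Real.zero_rpow hp.ne']
        split_ifs <;> simp_all
        norm_num
      · simp [hubFollowerLoss, hiS, hia, hib]
        ring
    · intro j hj hji
      rw [transitionMatrix_hub_of_ne W a b d _ i (Finset.ne_of_mem_erase hj), if_neg hji.symm,
        Real.zero_rpow hp.ne']
    · intro h
      exact absurd (Finset.mem_erase.2 ⟨hia, hi⟩) h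

variable {W d} {p w γ : ℝ}

lemma exp_neg_mul_le (hγ : 0 < γ) (hw : 0 < w) {x : ℝ} (hx : w ≤ x) (hd : γ ≤ d) :
    Real.exp (-(d * x)) ≤ Real.exp (-(γ * w)) :=
  Real.exp_le_exp.2 (neg_le_neg (mul_le_mul hd hx hw.le (hγ.le.trans hd)))

lemma exp_neg_mul_lt_one (hγ : 0 < γ) (hw : 0 < w) : Real.exp (-(γ * w)) < 1 :=
  Real.exp_lt_one_iff.2 (neg_lt_zero.2 (mul_pos hγ hw))

lemma hubLeaderLoss_mem (hp : 1 ≤ p) (hγ : 0 < γ) (hw : 0 < w) (hd : γ ≤ d)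
    (hW : ∀ i j, i ≠ j → w ≤ W i j) (i : Fin n) :
    0 ≤ hubLeaderLoss W a b d p i ∧ hubLeaderLoss W a b d p i ≤ 2 := by
  unfold hubLeaderLoss
  split_ifs with h
  · norm_num
  · have h1 := (exp_neg_mul_le hγ hw (hW i a fun h' => h (Or.inl h')) hd).trans
      (exp_neg_mul_lt_one hγ hw).le
    have h2 := Real.exp_nonneg (-(d * W i a))
    have := Real.rpow_nonneg h2 p
    have := rpow_le_self_of_mem_unit h2 h1 hp
    constructor <;> linarith

lemma hubFollowerLoss_mem (hp : 1 ≤ p) (hγ : 0 < γ) (hw : 0 < w) (hd : γ ≤ d)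
    (hW : ∀ i j, i ≠ j → w ≤ W i j) (i : Fin n) :
    0 ≤ hubFollowerLoss W a b d p i ∧ hubFollowerLoss W a b d p i ≤ 2 := by
  unfold hubFollowerLoss
  split_ifs with h
  · norm_num
  · have h1 := (exp_neg_mul_le hγ hw (hW i a fun h' => h (Or.inl h')) hd).trans
      (exp_neg_mul_lt_one hγ hw).le
    have h2 := Real.exp_nonneg (-(d * W i a))
    have := Real.rpow_nonneg h2 p
    have := rpow_le_self_of_mem_unit h2 h1 hp
    have := Real.rpow_nonneg (sub_nonneg.2 h1) p
    have := rpow_le_self_of_mem_unit (sub_nonneg.2 h1) (by linarith) hp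
    constructor <;> linarith

/-- With x the exponential at node i, the difference is 1 - x^p + (1 - x)^p ≥ 1 - x, since x^p ≤ x.
-/
lemma hubLeaderLoss_le (hp : 1 ≤ p) (hγ : 0 < γ) (hw : 0 < w) (hd : γ ≤ d)
    (hW : ∀ i j, i ≠ j → w ≤ W i j) (i : Fin n) :
    (if i = a ∨ i = b then 0 else 1 - Real.exp (-(γ * w))) ≤
      hubFollowerLoss W a b d p i - hubLeaderLoss W a b d p i := by
  unfold hubFollowerLoss hubLeaderLoss
  split_ifs with h
  · norm_num
  · have h0 := exp_neg_mul_le hγ hw (hW i a fun h' => h (Or.inl h')) hd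
    have h1 := h0.trans (exp_neg_mul_lt_one hγ hw).le
    have h2 := Real.exp_nonneg (-(d * W i a))
    have := rpow_le_self_of_mem_unit h2 h1 hp
    have := Real.rpow_nonneg (sub_nonneg.2 h1) p
    linarith

lemma sum_compl_singleton (f : Fin n → ℝ) (a : Fin n) : ∑ i ∈ {a}ᶜ, f i = ∑ i, f i - f a := by
  rw [← Finset.sum_add_sum_compl {a} f, Finset.sum_singleton]
  ring

/-- A leader other than the hub influences nobody and only removes its own loss. That loss is at
most 2, and the isolated node `b` attains 2. -/
lemma convergenceError_hub_le (hab : a ≠ b) (hp : 1 ≤ p) (hγ : 0 < γ) (hw : 0 < w) (hd : γ ≤ d)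
    (hW : ∀ i j, i ≠ j → w ≤ W i j) {S : Finset (Fin n)} (hS : S.card ≤ 1) (hSa : S ≠ {a}) :
    convergenceError p W (hubTopology a b) d {b} ≤
      convergenceError p W (hubTopology a b) d S := by
  have hp0 : 0 < p := by linarith
  have : Nonempty (Fin n) := ⟨a⟩
  rcases Finset.card_le_one_iff_subset_singleton.1 hS with ⟨s, hs⟩
  have hb : hubFollowerLoss W a b d p b = 2 := by simp [hubFollowerLoss]
  rw [convergenceError_hub_of_notMem W d {b} hp0 (by simpa using hab), sum_compl_singleton, hb]
  rcases Finset.subset_singleton_iff.1 hs with rfl | rfl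
  · rw [convergenceError_hub_of_notMem W d _ hp0 (by simp), Finset.compl_empty]
    linarith
  · have hsa : a ≠ s := fun h => hSa (by rw [h])
    rw [convergenceError_hub_of_notMem W d _ hp0 (by simpa using hsa), sum_compl_singleton]
    linarith [(hubFollowerLoss_mem (a := a) (b := b) hp hγ hw hd hW s).2]

lemma le_convergenceError_hub_sub (hab : a ≠ b) (hp : 1 ≤ p) (hγ : 0 < γ) (hw : 0 < w)
    (hd : γ ≤ d) (hW : ∀ i j, i ≠ j → w ≤ W i j) :
    ((n : ℝ) - 2) * (1 - Real.exp (-(γ * w))) ≤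
      convergenceError p W (hubTopology a b) d {b}
        - convergenceError p W (hubTopology a b) d {a} := by
  have hp0 : 0 < p := by linarith
  rw [convergenceError_hub_of_notMem W d {b} hp0 (by simpa using hab),
    convergenceError_hub_leader W d hp0, sum_compl_singleton, sum_compl_singleton]
  have h1 : hubFollowerLoss W a b d p b = 2 := by simp [hubFollowerLoss]
  -- The hub's own value is a convention: it cancels the removed loss 2 of `b`, so both sums run
  -- over all nodes.
  have h2 : hubLeaderLoss W a b d p a = 2 := by simp [hubLeaderLoss]
  rw [h1, h2, sub_sub_sub_cancel_right, ← Finset.sum_sub_distrib]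
  refine le_trans (le_of_eq ?_) (Finset.sum_le_sum fun i _ =>
    hubLeaderLoss_le (a := a) (b := b) hp hγ hw hd hW i)
  have h3 : ∀ i : Fin n, (if i = a ∨ i = b then 0 else 1 - Real.exp (-(γ * w))) =
      (1 - Real.exp (-(γ * w))) - ((if i = a then 1 - Real.exp (-(γ * w)) else 0)
        + (if i = b then 1 - Real.exp (-(γ * w)) else 0)) := by
    intro i
    by_cases hia : i = a
    · subst hia
      simp [hab]
    · by_cases hib : i = b <;> simp [hia, hib]
      exact fun h => absurd (hib.trans h) hia
  simp only [h3, Finset.sum_sub_distrib, Finset.sum_add_distrib, Finset.sum_ite_eq',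
    Finset.mem_univ, if_true, Finset.sum_const, Finset.card_univ, Fintype.card_fin, nsmul_eq_mul]
  ring

lemma sum_mem_of_mem {f : Fin n → ℝ} (h : ∀ i, 0 ≤ f i ∧ f i ≤ 2) (S : Finset (Fin n)) :
    0 ≤ ∑ i ∈ S, f i ∧ ∑ i ∈ S, f i ≤ 2 * n := by
  refine ⟨Finset.sum_nonneg fun i _ => (h i).1, ?_⟩
  calc ∑ i ∈ S, f i ≤ ∑ i, f i :=
        Finset.sum_le_univ_sum_of_nonneg fun i => (h i).1
    _ ≤ ∑ _i : Fin n, (2 : ℝ) := Finset.sum_le_sum fun i _ => (h i).2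
    _ = 2 * n := by simp [mul_comm]

lemma convergenceError_hub_sub_le (hab : a ≠ b) (hp : 1 ≤ p) (hγ : 0 < γ) (hw : 0 < w)
    (hd : γ ≤ d) (hW : ∀ i j, i ≠ j → w ≤ W i j) :
    convergenceError p W (hubTopology a b) d {b}
        - convergenceError p W (hubTopology a b) d {a} ≤ 2 * n := by
  have hp0 : 0 < p := by linarith
  rw [convergenceError_hub_of_notMem W d {b} hp0 (by simpa using hab),
    convergenceError_hub_leader W d hp0]
  linarith [(sum_mem_of_mem (hubLeaderLoss_mem (a := a) (b := b) hp hγ hw hd hW) {a}ᶜ).1,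
    (sum_mem_of_mem (hubFollowerLoss_mem (a := a) (b := b) hp hγ hw hd hW) {b}ᶜ).2]

end HubTopology

/-! ### Broadcast topologies with equal weights. -/

/-- The number of broadcasting nodes in `S`. -/
def broadcasters {n : ℕ} (b : Fin n → Bool) (S : Finset (Fin n)) : ℕ :=
  (S.filter fun i => b i = true).card

/-- The off-diagonal transition probability to a broadcasting follower. -/
noncomputable def broadcastRate {n : ℕ} (q : ℝ) (b : Fin n → Bool) (S : Finset (Fin n)) : ℝ :=
  (q ^ broadcasters b S - q ^ broadcasters b Finset.univ) / broadcasters b Sᶜ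

/-- The transition probabilities between followers in a broadcast topology. -/
noncomputable def broadcastEntry {n : ℕ} (q : ℝ) (b : Fin n → Bool) (S : Finset (Fin n))
    (i j : Fin n) : ℝ :=
  (if i = j then q ^ broadcasters b Finset.univ else 0) + if b j = true then broadcastRate q b S else 0

/-- The convergence error in a broadcast topology with equal weights. -/
noncomputable def broadcastError {n : ℕ} (p q : ℝ) (b : Fin n → Bool) (S : Finset (Fin n)) : ℝ :=
  ∑ i ∈ Sᶜ, (∑ j ∈ Sᶜ, broadcastEntry q b S i j ^ p + (q ^ broadcasters b S) ^ p)

section Broadcast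

variable {n : ℕ}

lemma broadcasters_add_compl (b : Fin n → Bool) (S : Finset (Fin n)) :
    broadcasters b S + broadcasters b Sᶜ = broadcasters b Finset.univ := by
  unfold broadcasters
  rw [← Finset.card_union_of_disjoint, ← Finset.filter_union, Finset.union_compl]
  exact Finset.disjoint_filter_filter disjoint_compl_right

lemma broadcasters_eq_sum (b : Fin n → Bool) (S : Finset (Fin n)) :
    (broadcasters b S : ℝ) = ∑ i ∈ S, if b i = true then 1 else 0 := by
  simp [broadcasters]

lemma leaderLaplacian_broadcast_mulVec (c : ℝ) (b : Fin n → Bool) (S : Finset (Fin n))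
    (v : Fin n → ℝ) (i : Fin n) :
    (leaderLaplacian (Matrix.of fun _ _ => c) (broadcastTopology b) S *ᵥ v) i =
      if i ∈ S then 0 else
        c * (broadcasters b Finset.univ * v i - ∑ l, if b l = true then v l else 0) := by
  rw [leaderLaplacian_mulVec]
  congr 1
  simp only [broadcastTopology, Matrix.of_apply]
  rw [← Finset.mul_sum, Finset.sum_filter, broadcasters_eq_sum, Finset.sum_mul,
    ← Finset.sum_sub_distrib]
  congr 1
  refine Finset.sum_congr rfl fun l _ => ?_
  by_cases hl : l = i
  · subst hl
    split_ifs <;> simp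
  · by_cases hb : b l = true <;> simp [hl, hb]

variable (c d : ℝ) (b : Fin n → Bool) (S : Finset (Fin n))

lemma exp_neg_mul_natCast (k : ℕ) : Real.exp (-(d * (c * k))) = Real.exp (-(d * c)) ^ k := by
  rw [← Real.exp_nat_mul]
  congr 1
  ring

/-- Each follower sees the same number of broadcasting leaders, so the indicator of the followers is
an eigenvector, with eigenvalue c times that number. -/
lemma transitionMatrix_broadcast_mulVec_compl :
    transitionMatrix (Matrix.of fun _ _ => c) (broadcastTopology b) d S *ᵥ
        (fun i => if i ∈ S then 0 else 1) =
      Real.exp (-(d * c)) ^ broadcasters b S • fun i => if i ∈ S then (0 : ℝ) else 1 := by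
  rw [← exp_neg_mul_natCast]
  refine transitionMatrix_mulVec_of_eigen d ?_
  funext i
  rw [leaderLaplacian_broadcast_mulVec]
  by_cases hi : i ∈ S
  · simp [hi]
  · have h : (∑ l, if b l = true then if l ∈ S then (0 : ℝ) else 1 else 0) =
        broadcasters b Sᶜ := by
      rw [broadcasters_eq_sum, ← Finset.sum_filter_add_sum_filter_not Finset.univ (· ∈ S),
        Finset.sum_eq_zero, zero_add]
      · refine Finset.sum_congr (by ext; simp) fun l hl => ?_
        simp [Finset.mem_compl.1 hl]
      · intro l hl
        simp [(Finset.mem_filter.1 hl).2]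
    rw [h]
    simp only [hi, if_false, Pi.smul_apply, smul_eq_mul, mul_one]
    rw [← broadcasters_add_compl b S]
    push_cast
    ring

lemma sum_compl_transitionMatrix_broadcast {i : Fin n} (hi : i ∉ S) :
    ∑ j ∈ Sᶜ, transitionMatrix (Matrix.of fun _ _ => c) (broadcastTopology b) d S i j =
      Real.exp (-(d * c)) ^ broadcasters b S := by
  have h := congrFun (transitionMatrix_broadcast_mulVec_compl c d b S) i
  simp only [Pi.smul_apply, hi, if_false, smul_eq_mul, mul_one] at h
  rw [← h, Matrix.mulVec, dotProduct, ← Finset.sum_add_sum_compl S (fun j => _ * _)]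
  simp only [mul_ite, mul_one, mul_zero]
  rw [Finset.sum_congr rfl fun l (hl : l ∈ S) => if_pos hl,
    Finset.sum_congr rfl fun l (hl : l ∈ Sᶜ) => if_neg (Finset.mem_compl.1 hl)]
  simp

lemma broadcasters_compl_pos {b : Fin n → Bool} {S : Finset (Fin n)} {j : Fin n} (hj : j ∉ S)
    (hb : b j = true) : 0 < broadcasters b Sᶜ :=
  Finset.card_pos.2 ⟨j, by simp [hj, hb]⟩

lemma transitionMatrix_broadcast_apply {i j : Fin n} (hi : i ∉ S) (hj : j ∉ S) :
    transitionMatrix (Matrix.of fun _ _ => c) (broadcastTopology b) d S i j =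
      broadcastEntry (Real.exp (-(d * c))) b S i j := by
  unfold broadcastEntry
  by_cases hb : b j = true
  · have hκ : (broadcasters b Sᶜ : ℝ) ≠ 0 := by
      exact_mod_cast (broadcasters_compl_pos hj hb).ne'
    set κ : ℝ := (broadcasters b Sᶜ : ℝ) with hκ_def
    set u : Fin n → ℝ := fun i => if i ∈ S then 0 else 1 with hu
    have hsum : (∑ l, if b l = true then u l else 0) = κ := by
      rw [hκ_def, broadcasters_eq_sum, ← Finset.sum_filter_add_sum_filter_not Finset.univ (· ∈ S),
        Finset.sum_eq_zero, zero_add]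
      · refine Finset.sum_congr (by ext; simp) fun l hl => ?_
        simp [hu, Finset.mem_compl.1 hl]
      · intro l hl
        simp [hu, (Finset.mem_filter.1 hl).2]
    -- Subtracting `κ⁻¹ • u` makes the values at the broadcasters sum to zero, so the Laplacian acts
    -- on this vector as multiplication by c times the number of all broadcasters.
    have heig : leaderLaplacian (Matrix.of fun _ _ => c) (broadcastTopology b) S *ᵥ
        (Pi.single j 1 - κ⁻¹ • u) =
        (c * broadcasters b Finset.univ) • (Pi.single j (1 : ℝ) - κ⁻¹ • u) := by
      funext k
      rw [leaderLaplacian_broadcast_mulVec]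
      have h0 : (∑ l, if b l = true then (Pi.single j 1 - κ⁻¹ • u : Fin n → ℝ) l else 0) = 0 := by
        have : ∀ l, (if b l = true then (Pi.single j 1 - κ⁻¹ • u : Fin n → ℝ) l else 0) =
            (if l = j then 1 else 0) - κ⁻¹ * (if b l = true then u l else 0) := by
          intro l
          by_cases hl : l = j
          · subst hl
            simp [hb]
          · by_cases hbl : b l = true <;> simp [hbl, hl]
        simp only [this, Finset.sum_sub_distrib, ← Finset.mul_sum, hsum]
        simp [hκ]
      rw [h0]
      by_cases hk : k ∈ S
      · have : k ≠ j := ne_of_mem_of_not_mem hk hj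
        simp [hk, hu, this]
      · simp [hk, mul_assoc]
    have h1 := congrFun (transitionMatrix_mulVec_of_eigen d heig) i
    have h2 := congrFun (transitionMatrix_broadcast_mulVec_compl c d b S) i
    rw [exp_neg_mul_natCast, Matrix.mulVec_sub, Matrix.mulVec_smul, Matrix.mulVec_single_one] at h1
    simp only [Pi.sub_apply, Pi.smul_apply, smul_eq_mul, Matrix.col_apply, ← hu] at h1 h2
    rw [h2] at h1
    have hui : u i = 1 := by simp [hu, hi]
    rw [hui] at h1
    simp only [hb, if_true, broadcastRate, ← hκ_def, Pi.single_apply] at h1 ⊢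
    rw [div_eq_inv_mul]
    split_ifs at h1 ⊢ <;> linarith
  · have heig : leaderLaplacian (Matrix.of fun _ _ => c) (broadcastTopology b) S *ᵥ
        Pi.single j 1 = (c * broadcasters b Finset.univ) • Pi.single j (1 : ℝ) := by
      funext k
      rw [leaderLaplacian_broadcast_mulVec]
      have h0 : (∑ l, if b l = true then (Pi.single j 1 : Fin n → ℝ) l else 0) = 0 := by
        refine Finset.sum_eq_zero fun l _ => ?_
        by_cases hl : l = j
        · subst hl
          simp [hb]
        · simp [hl]
      rw [h0]
      by_cases hk : k ∈ S
      · have : k ≠ j := ne_of_mem_of_not_mem hk hj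
        simp [hk, this]
      · simp [hk, mul_assoc]
    rw [transitionMatrix_apply_of_eigen_single d heig, exp_neg_mul_natCast]
    simp [hb]

lemma convergenceError_broadcast (p : ℝ) :
    convergenceError p (Matrix.of fun _ _ => c) (broadcastTopology b) d S =
      broadcastError p (Real.exp (-(d * c))) b S := by
  unfold convergenceError broadcastError
  refine Finset.sum_congr rfl fun i hi => ?_
  have hiS := Finset.mem_compl.1 hi
  congr 1
  · exact Finset.sum_congr rfl fun j hj => by
      rw [transitionMatrix_broadcast_apply c d b S hiS (Finset.mem_compl.1 hj)]
  · rw [← sum_compl_transitionMatrix_broadcast c d b S hiS,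
      ← sum_transitionMatrix (Matrix.of fun _ _ => c) (broadcastTopology b) d S i,
      ← Finset.sum_add_sum_compl S, add_sub_cancel_left]

variable {b S} {p q : ℝ}

lemma broadcastRate_nonneg (hq0 : 0 ≤ q) (hq1 : q ≤ 1) : 0 ≤ broadcastRate q b S := by
  refine div_nonneg (sub_nonneg.2 (pow_le_pow_of_le_one hq0 hq1 ?_)) (Nat.cast_nonneg _)
  rw [← broadcasters_add_compl b S]
  exact Nat.le_add_right _ _

lemma broadcastEntry_nonneg (hq0 : 0 ≤ q) (hq1 : q ≤ 1) (i j : Fin n) :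
    0 ≤ broadcastEntry q b S i j := by
  have := broadcastRate_nonneg (b := b) (S := S) hq0 hq1
  unfold broadcastEntry
  positivity

lemma sum_broadcastEntry_le_one (hq0 : 0 ≤ q) (hq1 : q ≤ 1) {i : Fin n} (hi : i ∉ S) :
    ∑ j ∈ Sᶜ, broadcastEntry q b S i j ≤ 1 := by
  unfold broadcastEntry
  rw [Finset.sum_add_distrib, Finset.sum_ite_eq, if_pos (Finset.mem_compl.2 hi), ← Finset.sum_filter,
    Finset.sum_const, nsmul_eq_mul]
  have h : ((Sᶜ.filter fun j => b j = true).card : ℝ) * broadcastRate q b S ≤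
      q ^ broadcasters b S - q ^ broadcasters b Finset.univ := by
    unfold broadcastRate broadcasters
    rcases eq_or_ne ((Sᶜ.filter fun j => b j = true).card : ℝ) 0 with h0 | h0
    · rw [h0, zero_mul, sub_nonneg]
      exact pow_le_pow_of_le_one hq0 hq1
        (Finset.card_le_card (Finset.filter_subset_filter _ (Finset.subset_univ S)))
    · rw [mul_div_cancel₀ _ h0]
  have := pow_le_one₀ (n := broadcasters b S) hq0 hq1
  linarith

lemma broadcastError_mem (hp : 1 ≤ p) (hq0 : 0 ≤ q) (hq1 : q ≤ 1) :
    0 ≤ broadcastError p q b S ∧ broadcastError p q b S ≤ 2 * n := by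
  have hpow : 0 ≤ q ^ broadcasters b S := pow_nonneg hq0 _
  have hpow1 : q ^ broadcasters b S ≤ 1 := pow_le_one₀ hq0 hq1
  have hrpow := Real.rpow_nonneg hpow p
  have hrpow1 := Real.rpow_le_one hpow hpow1 (by linarith : 0 ≤ p)
  have hE := broadcastEntry_nonneg (b := b) (S := S) hq0 hq1
  have hterm : ∀ i ∈ Sᶜ, 0 ≤ ∑ j ∈ Sᶜ, broadcastEntry q b S i j ^ p + (q ^ broadcasters b S) ^ p ∧
      ∑ j ∈ Sᶜ, broadcastEntry q b S i j ^ p + (q ^ broadcasters b S) ^ p ≤ 2 := by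
    intro i hi
    have hsum := sum_broadcastEntry_le_one (b := b) hq0 hq1 (Finset.mem_compl.1 hi)
    have h0 : 0 ≤ ∑ j ∈ Sᶜ, broadcastEntry q b S i j ^ p :=
      Finset.sum_nonneg fun j _ => Real.rpow_nonneg (hE i j) p
    have h1 : ∑ j ∈ Sᶜ, broadcastEntry q b S i j ^ p ≤ ∑ j ∈ Sᶜ, broadcastEntry q b S i j :=
      Finset.sum_le_sum fun j hj => rpow_le_self_of_mem_unit (hE i j)
        ((Finset.single_le_sum (fun j _ => hE i j) hj).trans hsum) hp
    constructor <;> linarith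
  refine ⟨Finset.sum_nonneg fun i hi => (hterm i hi).1, ?_⟩
  calc broadcastError p q b S ≤ ∑ _i ∈ Sᶜ, (2 : ℝ) := Finset.sum_le_sum fun i hi => (hterm i hi).2
    _ = Sᶜ.card * 2 := by rw [Finset.sum_const, nsmul_eq_mul]
    _ ≤ n * 2 := by
        refine mul_le_mul_of_nonneg_right ?_ zero_le_two
        exact_mod_cast (Finset.card_le_univ _).trans_eq (Fintype.card_fin n)
    _ = 2 * n := mul_comm _ _

/-- After clearing denominators this is Bernoulli's inequality for q = 1 + (q - 1). It says that
turning the broadcasting leader into a follower raises the rate, although one more broadcaster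
shares the mass. -/
lemma pow_sub_pow_div_le (hq0 : 0 ≤ q) {K : ℕ} (hK : 0 < K) :
    (q - q ^ (K + 1)) / (K : ℝ) ≤ (1 - q ^ (K + 1)) / ((K + 1 : ℕ) : ℝ) := by
  have hK' : (0 : ℝ) < K := by exact_mod_cast hK
  have hb := one_add_mul_le_pow (a := q - 1) (by linarith) (K + 1)
  rw [add_sub_cancel] at hb
  push_cast at hb ⊢
  rw [div_le_div_iff₀ hK' (by linarith)]
  nlinarith

/-- Fewer leaders among the broadcasters and more broadcasting followers give a larger error. -/
lemma le_broadcastError_sub (hp : 0 ≤ p) (hq0 : 0 ≤ q) (hq1 : q ≤ 1) {b' : Fin n → Bool}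
    {S' : Finset (Fin n)} (hS : S' ⊆ S) (hcard : S.card ≤ 1)
    (hK : broadcasters b' Finset.univ = broadcasters b Finset.univ)
    (hS' : broadcasters b' S' = 0) (hb : ∀ j ∉ S, b j = true → b' j = true) :
    Sᶜ.card * (1 - (q ^ broadcasters b S) ^ p) ≤ broadcastError p q b' S' - broadcastError p q b S := by
  have hβ : broadcasters b S ≤ 1 := (Finset.card_filter_le _ _).trans hcard
  have hrate : ∀ j ∉ S, b j = true → broadcastRate q b S ≤ broadcastRate q b' S' := by
    intro j hj hbj
    have hpos := broadcasters_compl_pos hj hbj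
    have h1 := broadcasters_add_compl b S
    have h2 := broadcasters_add_compl b' S'
    unfold broadcastRate
    rw [hS', zero_add, hK] at h2
    rw [hS', hK, h2, ← h1, pow_zero]
    interval_cases broadcasters b S
    · simp
    · rw [add_comm 1, pow_one]
      exact pow_sub_pow_div_le hq0 hpos
  have hentry : ∀ i, ∀ j ∈ Sᶜ, broadcastEntry q b S i j ^ p ≤ broadcastEntry q b' S' i j ^ p := by
    intro i j hj
    have hj' := Finset.mem_compl.1 hj
    refine Real.rpow_le_rpow (broadcastEntry_nonneg hq0 hq1 i j) ?_ hp
    unfold broadcastEntry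
    rw [hK]
    refine add_le_add le_rfl ?_
    by_cases hbj : b j = true
    · simpa [hbj, hb j hj' hbj] using hrate j hj' hbj
    · rw [if_neg hbj]
      have := broadcastRate_nonneg (b := b') (S := S') hq0 hq1
      positivity
  have hE' : ∀ i j, 0 ≤ broadcastEntry q b' S' i j ^ p := fun i j =>
    Real.rpow_nonneg (broadcastEntry_nonneg hq0 hq1 i j) p
  have hSc : Sᶜ ⊆ S'ᶜ := Finset.compl_subset_compl.2 hS
  have h1 : ∑ i ∈ Sᶜ, (∑ j ∈ Sᶜ, broadcastEntry q b S i j ^ p + 1) ≤ broadcastError p q b' S' := by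
    unfold broadcastError
    rw [hS', pow_zero, Real.one_rpow]
    calc _ ≤ ∑ i ∈ Sᶜ, (∑ j ∈ S'ᶜ, broadcastEntry q b' S' i j ^ p + 1) := by
          refine Finset.sum_le_sum fun i _ => add_le_add ?_ le_rfl
          exact (Finset.sum_le_sum (hentry i)).trans
            (Finset.sum_le_sum_of_subset_of_nonneg hSc fun j _ _ => hE' i j)
      _ ≤ _ := Finset.sum_le_sum_of_subset_of_nonneg hSc fun i _ _ =>
          add_nonneg (Finset.sum_nonneg fun j _ => hE' i j) zero_le_one
  have h2 : ∑ i ∈ Sᶜ, (∑ j ∈ Sᶜ, broadcastEntry q b S i j ^ p + 1) - broadcastError p q b S =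
      Sᶜ.card * (1 - (q ^ broadcasters b S) ^ p) := by
    unfold broadcastError
    rw [← Finset.sum_sub_distrib, ← nsmul_eq_mul, ← Finset.sum_const]
    exact Finset.sum_congr rfl fun i _ => by ring
  linarith

lemma broadcastError_singleton_le_empty (hp : 0 ≤ p) (hq0 : 0 ≤ q) (hq1 : q ≤ 1)
    (b : Fin n → Bool) (s : Fin n) : broadcastError p q b {s} ≤ broadcastError p q b ∅ := by
  have h := le_broadcastError_sub (b := b) (b' := b) (S := {s}) (S' := ∅) hp hq0 hq1 (by simp) (by simp) rfl
    (by simp [broadcasters]) (fun _ _ h => h)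
  have h2 := Real.rpow_le_one (pow_nonneg hq0 _)
    (pow_le_one₀ (n := broadcasters b {s}) hq0 hq1) hp
  have h3 : (0 : ℝ) ≤ ({s}ᶜ : Finset (Fin n)).card * (1 - (q ^ broadcasters b {s}) ^ p) :=
    mul_nonneg (Nat.cast_nonneg _) (sub_nonneg.2 h2)
  linarith

lemma broadcasters_comp_perm (b : Fin n → Bool) (σ : Equiv.Perm (Fin n)) :
    broadcasters (b ∘ σ) Finset.univ = broadcasters b Finset.univ := by
  unfold broadcasters
  refine Finset.card_equiv σ fun i => ?_
  simp

lemma broadcastError_comp_perm (p q : ℝ) (b : Fin n → Bool) (σ : Equiv.Perm (Fin n)) (s : Fin n) :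
    broadcastError p q (b ∘ σ) {s} = broadcastError p q b {σ s} := by
  have h1 : broadcasters (b ∘ σ) {s} = broadcasters b {σ s} := by
    simp [broadcasters, Finset.filter_singleton]
    split_ifs <;> rfl
  have h2 : broadcasters (b ∘ σ) {s}ᶜ = broadcasters b {σ s}ᶜ := by
    have := broadcasters_add_compl (b ∘ σ) {s}
    have := broadcasters_add_compl b {σ s}
    have := broadcasters_comp_perm b σ
    omega
  unfold broadcastError
  refine Finset.sum_equiv σ (by simp) fun i _ => ?_
  rw [h1]
  congr 1
  refine Finset.sum_equiv σ (by simp) fun j _ => ?_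
  simp [broadcastEntry, broadcastRate, h1, h2, broadcasters_comp_perm]

lemma le_broadcastError_singleton_sub (hp : 1 ≤ p) (hq0 : 0 ≤ q) (hq1 : q ≤ 1)
    {b : Fin n → Bool} {s t : Fin n} (hs : b s = false) (ht : b t = true) :
    ((n : ℝ) - 1) * (1 - q) ≤ broadcastError p q b {s} - broadcastError p q b {t} := by
  -- Relabelling turns leader `s` under `b` into leader `t` under the swapped flips, so the leader
  -- set and the total number of broadcasters agree on both sides.
  have h := le_broadcastError_sub (b := b) (b' := b ∘ Equiv.swap s t) (S := {t}) (S' := {t}) (p := p)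
    (by linarith) hq0 hq1 subset_rfl (by simp) (broadcasters_comp_perm b _)
    (by simp [broadcasters, Finset.filter_singleton, hs]) (by
      intro j hj hbj
      by_cases hjs : j = s
      · simp [hjs, ht]
      · simpa [Equiv.swap_apply_of_ne_of_ne hjs (by simpa using hj)] using hbj)
  rw [broadcastError_comp_perm, Equiv.swap_apply_right] at h
  refine le_trans ?_ h
  have h1 : broadcasters b {t} = 1 := by simp [broadcasters, Finset.filter_singleton, ht]
  have hn : 1 ≤ n := Fin.pos t
  rw [h1, pow_one, Finset.card_compl, Fintype.card_fin, Finset.card_singleton, Nat.cast_sub hn,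
    Nat.cast_one]
  have hn' : (1 : ℝ) ≤ n := by exact_mod_cast hn
  exact mul_le_mul_of_nonneg_left (by linarith [rpow_le_self_of_mem_unit hq0 hq1 hp])
    (by linarith)

lemma sum_broadcastError_singleton (p q : ℝ) (s t : Fin n) :
    ∑ b : Fin n → Bool, broadcastError p q b {s} = ∑ b : Fin n → Bool, broadcastError p q b {t} := by
  refine Fintype.sum_equiv (Equiv.arrowCongr (Equiv.swap s t) (Equiv.refl Bool)) _ _ fun b => ?_
  have h : (Equiv.arrowCongr (Equiv.swap s t) (Equiv.refl Bool)) b = b ∘ Equiv.swap s t := by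
    funext i
    simp [Equiv.arrowCongr]
  rw [h, broadcastError_comp_perm, Equiv.swap_apply_right]

lemma sum_broadcastError_singleton_le (hp : 0 ≤ p) (hq0 : 0 ≤ q) (hq1 : q ≤ 1) (s : Fin n)
    {S : Finset (Fin n)} (hS : S.card ≤ 1) :
    ∑ b : Fin n → Bool, broadcastError p q b {s} ≤ ∑ b : Fin n → Bool, broadcastError p q b S := by
  have : Nonempty (Fin n) := ⟨s⟩
  rcases Finset.card_le_one_iff_subset_singleton.1 hS with ⟨t, ht⟩
  rcases Finset.subset_singleton_iff.1 ht with rfl | rfl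
  · exact Finset.sum_le_sum fun b _ => broadcastError_singleton_le_empty hp hq0 hq1 b s
  · exact (sum_broadcastError_singleton p q s t).le

/-- Second moment of the difference of the errors of two singletons under fair coin flips. -/
lemma le_sum_broadcastError_sub_sq (hp : 1 ≤ p) (hq0 : 0 ≤ q) (hq1 : q ≤ 1) {s t : Fin n}
    (hst : s ≠ t) :
    (((n : ℝ) - 1) * (1 - q)) ^ 2 / 2 ≤ ∑ b : Fin n → Bool,
      ((Fintype.card (Fin n → Bool) : ℝ))⁻¹ *
        (broadcastError p q b {s} - broadcastError p q b {t}) ^ 2 := by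
  set D : (Fin n → Bool) → ℝ := fun b => broadcastError p q b {s} - broadcastError p q b {t}
  set e := ((n : ℝ) - 1) * (1 - q)
  have hn : (1 : ℝ) ≤ n := by
    exact_mod_cast Fin.pos t
  have he : 0 ≤ e := mul_nonneg (by linarith) (by linarith)
  have hne : ∀ b : Fin n → Bool, b s ≠ b t → e ^ 2 ≤ D b ^ 2 := by
    intro b hb
    cases hs : b s <;> cases ht : b t
    · simp [hs, ht] at hb
    · exact pow_le_pow_left₀ he (le_broadcastError_singleton_sub hp hq0 hq1 hs ht) 2
    · have := le_broadcastError_singleton_sub hp hq0 hq1 ht hs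
      calc e ^ 2 ≤ (broadcastError p q b {t} - broadcastError p q b {s}) ^ 2 :=
            pow_le_pow_left₀ he this 2
        _ = D b ^ 2 := by ring
    · simp [hs, ht] at hb
  have hinv : Function.Involutive 
      (fun b : Fin n → Bool => (Function.update b s (!b s) : Fin n → Bool)) := by
    intro b
    simp
  obtain ⟨σ, hσ⟩ : ∃ σ : Equiv.Perm (Fin n → Bool), ∀ b, σ b = Function.update b s (!b s) :=
    ⟨hinv.toPerm, fun _ => rfl⟩
  -- Flipping the coin of `s` pairs the outcomes so that exactly one of each pair has `b s ≠ b t`;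
  -- this gives the factor 1/2.
  have hpair : ∀ b, e ^ 2 ≤ D b ^ 2 + D (σ b) ^ 2 := by
    intro b
    by_cases hb : b s = b t
    · have : e ^ 2 ≤ D (σ b) ^ 2 := hne _ (by
        simp [hσ, Function.update_of_ne hst.symm, hb])
      linarith [sq_nonneg (D b)]
    · linarith [hne b hb, sq_nonneg (D (σ b))]
  have hsum := Finset.sum_le_sum fun b (_ : b ∈ Finset.univ) => hpair b
  rw [Finset.sum_add_distrib, Equiv.sum_comp σ (fun b => D b ^ 2), Finset.sum_const,
    Finset.card_univ, nsmul_eq_mul] at hsum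
  rw [← Finset.mul_sum]
  have hc : (0 : ℝ) < Fintype.card (Fin n → Bool) := by exact_mod_cast Fintype.card_pos
  rw [inv_mul_eq_div, le_div_iff₀ hc]
  linarith

end Broadcast

/-! ### Choice of constants and the two lower bounds. -/

lemma exists_forall_sqrt_log_le {η : ℝ} (hη : 0 < η) :
    ∃ n₀ : ℕ, 4 ≤ n₀ ∧ ∀ n r : ℕ, n₀ ≤ n →
      1 / (r : ℝ) * Real.sqrt ((r : ℝ) / 2 * Real.log n) ≤
        1 / (r : ℝ) * (3 / 32 * (((n : ℝ) * η) ^ 2 / 16 / n) * Real.sqrt r) := by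
  have hκ : 0 < (3 / 512 * η ^ 2) ^ 2 := by positivity
  -- After squaring and cancelling r, the claim is ln n / 2 ≤ κn² with κ = (3η²/512)². By ln n ≤ n
  -- it suffices that n ≥ 1/(2κ).
  refine ⟨max 4 ⌈1 / (2 * (3 / 512 * η ^ 2) ^ 2)⌉₊, le_max_left _ _, fun n r hn => ?_⟩
  have hn4 : (4 : ℝ) ≤ n := by exact_mod_cast (le_max_left _ _).trans hn
  have hn' : 1 / (2 * (3 / 512 * η ^ 2) ^ 2) ≤ n := Nat.ceil_le.1 ((le_max_right _ _).trans hn)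
  rw [div_le_iff₀ (by positivity)] at hn'
  have hlog : Real.log n ≤ n := (Real.log_le_sub_one_of_pos (by linarith)).trans (by linarith)
  refine mul_le_mul_of_nonneg_left (Real.sqrt_le_iff.2 ⟨by positivity, ?_⟩) (by positivity)
  have h1 : (3 / 32 * (((n : ℝ) * η) ^ 2 / 16 / n) * Real.sqrt r) ^ 2 =
      r * ((3 / 512 * η ^ 2) ^ 2 * n ^ 2) := by
    have h0 : 3 / 32 * (((n : ℝ) * η) ^ 2 / 16 / n) = 3 / 512 * η ^ 2 * n := by
      field_simp
      ring
    rw [h0, mul_pow, Real.sq_sqrt (Nat.cast_nonneg r)]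
    ring
  rw [h1, div_mul_eq_mul_div, mul_div_assoc]
  refine mul_le_mul_of_nonneg_left ?_ (Nat.cast_nonneg r)
  nlinarith

/-- Two hub topologies can be mixed such that both hubs are optimal in expectation. -/
lemma exists_balanced_hub_mixture {n : ℕ} (hn : 4 ≤ n) {p w γ d : ℝ} (hp : 1 ≤ p) (hw : 0 < w)
    (hγ : 0 < γ) (hd : γ ≤ d) {W : Matrix (Fin n) (Fin n) ℝ} (hW : ∀ i j, i ≠ j → w ≤ W i j)
    {a b : Fin n} (hab : a ≠ b) :
    ∃ q : Bool → ℝ, (∀ x, 0 ≤ q x) ∧ ∑ x, q x = 1 ∧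
      (∀ S : Finset (Fin n), S.card ≤ 1 →
        ∑ x, q x * convergenceError p W (if x then hubTopology a b else hubTopology b a) d {a} ≤
          ∑ x, q x * convergenceError p W (if x then hubTopology a b else hubTopology b a) d S) ∧
      (∀ S : Finset (Fin n), S.card ≤ 1 →
        ∑ x, q x * convergenceError p W (if x then hubTopology a b else hubTopology b a) d {b} ≤
          ∑ x, q x * convergenceError p W (if x then hubTopology a b else hubTopology b a) d S) ∧
      (∀ x : Bool, |convergenceError p W (if x then hubTopology a b else hubTopology b a) d {a}
        - convergenceError p W (if x then hubTopology a b else hubTopology b a) d {b}| ≤ 2 * n) ∧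
      ((n : ℝ) * (1 - Real.exp (-(γ * w)))) ^ 2 / 16 ≤
        ∑ x, q x * (convergenceError p W (if x then hubTopology a b else hubTopology b a) d {a}
          - convergenceError p W (if x then hubTopology a b else hubTopology b a) d {b}) ^ 2 := by
  have hn' : (4 : ℝ) ≤ n := by exact_mod_cast hn
  have hη : 0 < 1 - Real.exp (-(γ * w)) := sub_pos.2 (exp_neg_mul_lt_one hγ hw)
  set η := 1 - Real.exp (-(γ * w))
  have h1 := le_convergenceError_hub_sub hab hp hγ hw hd hW
  have h2 := le_convergenceError_hub_sub hab.symm hp hγ hw hd hW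
  have h1' := convergenceError_hub_sub_le hab hp hγ hw hd hW
  have h2' := convergenceError_hub_sub_le hab.symm hp hγ hw hd hW
  have hS1 := fun S hS => convergenceError_hub_le (S := S) hab hp hγ hw hd hW hS
  have hS2 := fun S hS => convergenceError_hub_le (S := S) hab.symm hp hγ hw hd hW hS
  set f := convergenceError p W (hubTopology a b) d
  set g := convergenceError p W (hubTopology b a) d
  have he : n * η / 4 ≤ ((n : ℝ) - 2) * η := by nlinarith
  have he0 : 0 < n * η / 4 := by positivity
  have hx : 0 < f {b} - f {a} := by linarith
  have hy : 0 < g {a} - g {b} := by linarith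
  set x := f {b} - f {a} with hx_def
  set y := g {a} - g {b} with hy_def
  have hq1 : 0 ≤ y / (x + y) := by positivity
  have hq2 : 0 ≤ x / (x + y) := by positivity
  have hq : y / (x + y) + x / (x + y) = 1 := by
    field_simp
    ring
  -- Each topology is weighted by the other one's gap, so `{a}` and `{b}` have equal expected error.
  have hbal : y / (x + y) * x = x / (x + y) * y := by ring
  generalize y / (x + y) = α at *
  generalize x / (x + y) = β at *
  have hαx : α * x = α * f {b} - α * f {a} := by rw [hx_def]; ring
  have hβy : β * y = β * g {a} - β * g {b} := by rw [hy_def]; ring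
  have hαx0 := mul_nonneg hq1 hx.le
  have hmain : ∀ S : Finset (Fin n), S.card ≤ 1 →
      α * f {a} + β * g {a} ≤ α * f S + β * g S := by
    intro S hS
    by_cases hSa : S = {a}
    · rw [hSa]
    · by_cases hSb : S = {b}
      · rw [hSb]
        linarith
      · have := mul_le_mul_of_nonneg_left (hS1 S hS hSa) hq1
        have := mul_le_mul_of_nonneg_left (hS2 S hS hSb) hq2
        linarith
  refine ⟨fun z => if z then α else β, ?_, ?_, ?_, ?_, ?_, ?_⟩
  · rintro (_ | _) <;> simpa
  · simpa using hq
  · simpa using hmain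
  · intro S hS
    have := hmain S hS
    simp only [Fintype.sum_bool, if_true, Bool.false_eq_true, if_false]
    linarith
  · rintro (_ | _)
    · simp only [Bool.false_eq_true, if_false]
      rw [abs_of_pos hy]
      exact h2'
    · simp only [if_true]
      rw [abs_sub_comm, abs_of_pos hx]
      exact h1'
  · simp only [Fintype.sum_bool, if_true, Bool.false_eq_true, if_false]
    have hx2 : (n * η / 4) ^ 2 ≤ (f {a} - f {b}) ^ 2 := by
      rw [← neg_sq (f {a} - f {b}), neg_sub]
      exact pow_le_pow_left₀ he0.le (he.trans h1) 2
    have hy2 : (n * η / 4) ^ 2 ≤ (g {a} - g {b}) ^ 2 :=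
      pow_le_pow_left₀ he0.le (he.trans h2) 2
    have := mul_le_mul_of_nonneg_left hx2 hq1
    have := mul_le_mul_of_nonneg_left hy2 hq2
    calc (n * η) ^ 2 / 16 = (α + β) * (n * η / 4) ^ 2 := by rw [hq]; ring
      _ ≤ _ := by linarith

lemma exists_topologies_le_expectedRegret {n r : ℕ} (hn : 4 ≤ n) (hr : 0 < r) {p w γ : ℝ}
    (hp : 1 ≤ p) (hw : 0 < w) (hγ : 0 < γ) {δ : Fin r → ℝ} (hδ : ∀ m, γ ≤ δ m)
    {W : Fin r → Matrix (Fin n) (Fin n) ℝ} (hW : ∀ m i j, i ≠ j → w ≤ W m i j)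
    (μ : RandomizedAlgorithm n 1 r) :
    ∃ G : Fin r → NetTopology n,
      1 / (r : ℝ) * (3 / 32 * (((n : ℝ) * (1 - Real.exp (-(γ * w)))) ^ 2 / 16 / n) * Real.sqrt r) ≤
        expectedRegret p W δ μ G := by
  have hab : (⟨0, by omega⟩ : Fin n) ≠ ⟨1, by omega⟩ := by simp
  generalize (⟨0, by omega⟩ : Fin n) = a at hab
  generalize (⟨1, by omega⟩ : Fin n) = b at hab
  choose q hq0 hq hA hB hbound hv using fun m =>
    exists_balanced_hub_mixture hn hp hw hγ (hδ m) (hW m) hab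
  have hn0 : (0 : ℝ) < n := by exact_mod_cast (by omega : 0 < n)
  have hreg := le_productExpect_regret hr (p := p) (W := W) (δ := δ) hq0 hq
    (fun _ x => if x = true then hubTopology a b else hubTopology b a)
    ⟨{a}, by simp⟩ ⟨{b}, by simp⟩ (fun m S => hA m S.1 S.2) (fun m S => hB m S.1 S.2) hn0
    hbound hv
  have hexp := le_productExpect_expectedRegret
    (T := fun _ x => if x = true then hubTopology a b else hubTopology b a) hreg μ
  have hex := exists_le_of_le_productExpect hq0 hq hexp
  exact hex.elim fun x hx => ⟨_, hx⟩

lemma le_finExpect_coinTopologies_expectedRegret {n r : ℕ} (hn : 4 ≤ n) (hr : 0 < r) {p w γ : ℝ}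
    (hp : 1 ≤ p) (hw : 0 < w) (hγ : 0 < γ) {δ : Fin r → ℝ} (hδ : ∀ m, γ ≤ δ m) {c : Fin r → ℝ}
    (hc : ∀ m, w ≤ c m) (μ : RandomizedAlgorithm n 1 r) :
    1 / (r : ℝ) * (3 / 32 * (((n : ℝ) * (1 - Real.exp (-(γ * w)))) ^ 2 / 16 / n) * Real.sqrt r) ≤
      finExpect (coinTopologies n r)
        (expectedRegret p (fun m => Matrix.of fun _ _ => c m) δ μ) := by
  rw [finExpect_coinTopologies]
  have hab : (⟨0, by omega⟩ : Fin n) ≠ ⟨1, by omega⟩ := by simp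
  generalize (⟨0, by omega⟩ : Fin n) = a at hab
  generalize (⟨1, by omega⟩ : Fin n) = b at hab
  have hn' : (4 : ℝ) ≤ n := by exact_mod_cast hn
  have hp0 : 0 ≤ p := by linarith
  have hη := exp_neg_mul_lt_one hγ hw
  have hq0 : ∀ m, 0 ≤ Real.exp (-(δ m * c m)) := fun m => Real.exp_nonneg _
  have hq : ∀ m, Real.exp (-(δ m * c m)) ≤ Real.exp (-(γ * w)) := fun m =>
    exp_neg_mul_le hγ hw (hc m) (hδ m)
  have hq1 : ∀ m, Real.exp (-(δ m * c m)) ≤ 1 := fun m => (hq m).trans hη.le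
  refine le_productExpect_expectedRegret (fun alg => le_productExpect_regret hr
    (fun _ _ => by positivity) (fun _ => by simp) (fun _ => broadcastTopology)
    ⟨{a}, by simp⟩ ⟨{b}, by simp⟩ ?_ ?_ (by linarith) ?_ ?_ alg) μ
  · intro m S
    simp only [convergenceError_broadcast, ← Finset.mul_sum]
    exact mul_le_mul_of_nonneg_left
      (sum_broadcastError_singleton_le hp0 (hq0 m) (hq1 m) a S.2) (by positivity)
  · intro m S
    simp only [convergenceError_broadcast, ← Finset.mul_sum]
    exact mul_le_mul_of_nonneg_left
      (sum_broadcastError_singleton_le hp0 (hq0 m) (hq1 m) b S.2) (by positivity)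
  · intro m x
    simp only [convergenceError_broadcast]
    have h1 := broadcastError_mem (b := x) (S := {a}) hp (hq0 m) (hq1 m)
    have h2 := broadcastError_mem (b := x) (S := {b}) hp (hq0 m) (hq1 m)
    rw [abs_le]
    constructor <;> linarith
  · intro m
    simp only [convergenceError_broadcast]
    refine le_trans ?_ (le_sum_broadcastError_sub_sq hp (hq0 m) (hq1 m) hab)
    -- The crude bound n - 1 ≥ n/2 gives second moment at least (nη)²/8, with η = 1 - exp(-γw). This
    -- is more than the (nη)²/16 of the hub construction, so one choice of n₀ serves both claims.
    have h1 : (n : ℝ) / 2 * (1 - Real.exp (-(γ * w))) ≤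
        ((n : ℝ) - 1) * (1 - Real.exp (-(δ m * c m))) :=
      mul_le_mul (by linarith) (by linarith [hq m]) (by linarith) (by linarith)
    have h2 := pow_le_pow_left₀ (mul_nonneg (by linarith) (by linarith)) h1 2
    nlinarith [sq_nonneg ((n : ℝ) * (1 - Real.exp (-(γ * w))))]

theorem mainTheorem8 (p w γ : ℝ) (hp : 1 ≤ p) (hw : 0 < w) (hγ : 0 < γ) :
    ∃ n₀ r₀ : ℕ, ∀ n r : ℕ, n₀ ≤ n → r₀ ≤ r →
      ∀ δ : Fin r → ℝ, (∀ m, γ ≤ δ m) →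
        (∀ W : Fin r → Matrix (Fin n) (Fin n) ℝ, (∀ m i j, i ≠ j → w ≤ W m i j) →
          ∀ μ : RandomizedAlgorithm n 1 r, ∃ G : Fin r → NetTopology n,
            (1 / (r : ℝ)) * Real.sqrt ((r : ℝ) / 2 * Real.log n) ≤ expectedRegret p W δ μ G) ∧
        (∀ c : Fin r → ℝ, (∀ m, w ≤ c m) → ∀ μ : RandomizedAlgorithm n 1 r,
          (1 / (r : ℝ)) * Real.sqrt ((r : ℝ) / 2 * Real.log n) ≤
            finExpect (coinTopologies n r)
              (expectedRegret p (fun m => Matrix.of fun _ _ => c m) δ μ)) := by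
  obtain ⟨n₀, hn₀, hlog⟩ := exists_forall_sqrt_log_le (sub_pos.2 (exp_neg_mul_lt_one hγ hw))
  refine ⟨n₀, 1, fun n r hn hr δ hδ => ⟨fun W hW μ => ?_, fun c hc μ => ?_⟩⟩
  · obtain ⟨G, hG⟩ := exists_topologies_le_expectedRegret (hn₀.trans hn) hr hp hw hγ hδ hW μ
    exact ⟨G, (hlog n r hn).trans hG⟩
  · exact (hlog n r hn).trans
      (le_finExpect_coinTopologies_expectedRegret (hn₀.trans hn) hr hp hw hγ hδ hc μ)
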